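/- Let $k\ge 1$ and $n_1,\dots,n_k\ge 1$ be integers and let $\mathcal E$ be a complex Hilbert space. Let $F^2(H_{n_i})$ be the full Fock space of an $n_i$-dimensional Hilbert space $H_{n_i}$, with orthonormal basis $e^i_\alpha$, $\alpha$ in the free monoid $\mathbb F_{n_i}^+$ on generators $g^i_1,\dots,g^i_{n_i}$; let $S_{i,j}e^i_\alpha=e^i_{g^i_j\alpha}$ be the left creation operators, and let $\mathbf S_{i,j}$ be the operator on the Hilbert tensor product $\otimes_{i=1}^kF^2(H_{n_i})$ acting as $S_{i,j}$ on the $i$-th factor and as the identity on the others. Write $\mathbf S\otimes I_{\mathcal E}$ for the family $(\mathbf S_{i,j}\otimes I_{\mathcal E})_{1\le i\le k,\,1\le j\le n_i}$ on $\otimes_{i=1}^kF^2(H_{n_i})\otimes\mathcal E$. A closed subspace is invariant if it is invariant under all the operators $\mathbf S_{i,j}\otimes I_{\mathcal E}$, and reducing if it is invariant under all of these operators and their adjoints; a reducing subspace is nontrivial if it is neither $\{0\}$ nor the whole space. Let $\mathcal M$ and $\mathcal N$ be invariant subspaces of $\otimes_{i=1}^kF^2(H_{n_i})\otimes\mathcal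 E$ which do not contain nontrivial reducing subspaces. If $P_{\mathcal M^\perp}(\mathbf S\otimes I_{\mathcal E})|_{\mathcal M^\perp}$ is unitarily equivalent to $P_{\mathcal N^\perp}(\mathbf S\otimes I_{\mathcal E})|_{\mathcal N^\perp}$, that is, if there is a unitary $Z:\mathcal M^\perp\to\mathcal N^\perp$ with $Z\,P_{\mathcal M^\perp}(\mathbf S_{i,j}\otimes I_{\mathcal E})|_{\mathcal M^\perp}=P_{\mathcal N^\perp}(\mathbf S_{i,j}\otimes I_{\mathcal E})|_{\mathcal N^\perp}\,Z$ for all $i,j$, then there is a unitary operator $U$ on $\mathcal E$ such that $$(I\otimes U)P_{\mathcal M}=P_{\mathcal N}(I\otimes U).$$ Conversely, suppose that $\mathcal M$ and $\mathcal N$ are of Beurling type, where an invariant subspace is of Beurling type if it is the range of a bounded operator $\Psi:\otimes_{i=1}^kF^2(H_{n_i})\otimes\mathcal L\to\otimes_{i=1}^kF^2(H_{n_i})\otimes\mathcal E$, for some complex Hilbert space $\mathcal L$, which is a partial isometry and satisfies $\Psi(\mathbf S_{i,j}\otimes I_{\mathcal L})=(\mathbf S_{i,j}\otimes I_{\mathcal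 E})\Psi$ for all $i,j$. If there is a unitary operator $U$ on $\mathcal E$ such that $(I\otimes U)P_{\mathcal M}=P_{\mathcal N}(I\otimes U)$, then $P_{\mathcal M^\perp}(\mathbf S\otimes I_{\mathcal E})|_{\mathcal M^\perp}$ is unitarily equivalent to $P_{\mathcal N^\perp}(\mathbf S\otimes I_{\mathcal E})|_{\mathcal N^\perp}$. -/

import Mathlib

noncomputable section

namespace Polyball

open scoped InnerProductSpace

/-! ## Fock spaces and their Hilbert tensor products -/

/-- The full Fock space `F²(H_m)` of an `m`-dimensional Hilbert space, in its standard orthonormal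
basis `e_α`, where `α` runs over the free monoid on `m` generators. -/
abbrev Fock (m : ℕ) : Type := lp (fun _ : FreeMonoid (Fin m) => ℂ) 2

/-- Tuples of words `(α₁, …, α_k)`, with `α_i` in the free monoid on `n i` generators. -/
abbrev MultiWord {k : ℕ} (n : Fin k → ℕ) : Type := ∀ i, FreeMonoid (Fin (n i))

/-- The Hilbert tensor product `F²(H_{n₁}) ⊗ ⋯ ⊗ F²(H_{n_k}) ⊗ E`: a vector is written uniquely as
`∑ e_{α₁} ⊗ ⋯ ⊗ e_{α_k} ⊗ x_α` with `∑ ‖x_α‖² < ∞`. The elementary tensors are given by `tmul`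
below; `inner_tmul` and `dense_span_tmul` say that this is the Hilbert tensor product. -/
abbrev FockTensor {k : ℕ} (n : Fin k → ℕ) (E : Type*) [NormedAddCommGroup E]
    [InnerProductSpace ℂ E] : Type _ := lp (fun _ : MultiWord n => E) 2

section General

variable {ι κ : Type*} {E F : Type*} [NormedAddCommGroup E] [InnerProductSpace ℂ E]
  [NormedAddCommGroup F] [InnerProductSpace ℂ F]

open Classical in
/-- The isometric embedding `x ↦ e_a ⊗ x` of `E` into `ℓ²(ι) ⊗ E = ℓ²(ι, E)`. -/
def basisTensor (a : ι) : E →ₗᵢ[ℂ] lp (fun _ : ι => E) 2 where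
  toLinearMap := lp.lsingle (E := fun _ : ι => E) 2 a
  norm_map' x := lp.norm_single (E := fun _ : ι => E) (p := 2) (by norm_num) a x

theorem basisTensor_eq_single [DecidableEq ι] (a : ι) (x : E) :
    basisTensor a x = lp.single (E := fun _ : ι => E) 2 a x := by
  change @lp.single ι (fun _ : ι => E) _ (Classical.decEq ι) 2 a x = _
  congr
  exact Subsingleton.elim _ _

open Classical in
theorem basisTensor_apply (a b : ι) (x : E) :
    (basisTensor a x : lp (fun _ : ι => E) 2) b = if b = a then x else 0 := by
  change (Pi.single a x : ι → E) b = _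
  rw [Pi.single_apply]

theorem inner_basisTensor_left (a : ι) (x : E) (f : lp (fun _ : ι => E) 2) :
    ⟪basisTensor a x, f⟫_ℂ = ⟪x, f a⟫_ℂ := by
  classical
  rw [basisTensor_eq_single]
  exact lp.inner_single_left (𝕜 := ℂ) (G := fun _ : ι => E) a x f

theorem inner_basisTensor_of_ne {a b : ι} (h : a ≠ b) (x y : E) :
    ⟪basisTensor a x, basisTensor b y⟫_ℂ = 0 := by
  rw [inner_basisTensor_left, basisTensor_apply, if_neg h, inner_zero_right]

/-- The isometry `e_a ⊗ x ↦ e_{σ a} ⊗ x` of `ℓ²(ι) ⊗ E` into `ℓ²(κ) ⊗ E`, for `σ` injective. -/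
def basisShift [CompleteSpace E] (σ : ι → κ) (hσ : Function.Injective σ) :
    lp (fun _ : ι => E) 2 →ₗᵢ[ℂ] lp (fun _ : κ => E) 2 :=
  OrthogonalFamily.linearIsometry (𝕜 := ℂ) (G := fun _ : ι => E)
    (V := fun a => basisTensor (σ a))
    fun _ _ hab x y => inner_basisTensor_of_ne (hσ.ne hab) x y

/-- The isometry `I ⊗ U : e_a ⊗ x ↦ e_a ⊗ U x` of `ℓ²(ι) ⊗ E` into `ℓ²(ι) ⊗ F`, for an isometry
`U : E → F`. -/
def idTensor [CompleteSpace F] (U : E →ₗᵢ[ℂ] F) :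
    lp (fun _ : ι => E) 2 →ₗᵢ[ℂ] lp (fun _ : ι => F) 2 :=
  OrthogonalFamily.linearIsometry (𝕜 := ℂ) (G := fun _ : ι => E)
    (V := fun a => (basisTensor a).comp U)
    fun _ _ hab x y => inner_basisTensor_of_ne hab (U x) (U y)

theorem basisShift_basisTensor [CompleteSpace E] (σ : ι → κ) (hσ : Function.Injective σ)
    (a : ι) (x : E) : basisShift σ hσ (basisTensor a x) = basisTensor (σ a) x := by
  classical
  have h := OrthogonalFamily.linearIsometry_apply_single (𝕜 := ℂ) (G := fun _ : ι => E)
    (V := fun a => basisTensor (σ a))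
    (fun _ _ hab x y => inner_basisTensor_of_ne (hσ.ne hab) x y) (i := a) x
  rw [← h, basisShift, basisTensor_eq_single]

theorem basisShift_apply [CompleteSpace E] (σ : ι → κ) (hσ : Function.Injective σ)
    (f : lp (fun _ : ι => E) 2) (a : ι) : basisShift σ hσ f (σ a) = f a := by
  refine ext_inner_left ℂ fun x => ?_
  rw [← inner_basisTensor_left, ← inner_basisTensor_left, ← basisShift_basisTensor σ hσ,
    LinearIsometry.inner_map_map]

theorem basisShift_apply_of_notMem [CompleteSpace E] (σ : ι → κ) (hσ : Function.Injective σ)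
    (f : lp (fun _ : ι => E) 2) (b : κ) (hb : b ∉ Set.range σ) : basisShift σ hσ f b = 0 := by
  refine ext_inner_left ℂ fun x => ?_
  rw [← inner_basisTensor_left, inner_zero_right]
  have h := OrthogonalFamily.hasSum_linearIsometry (𝕜 := ℂ) (G := fun _ : ι => E)
    (V := fun a => basisTensor (σ a))
    (fun _ _ hab x y => inner_basisTensor_of_ne (hσ.ne hab) x y) f
  have h' := h.mapL (innerSL ℂ (basisTensor b x))
  refine h'.unique ?_
  convert hasSum_zero using 2 with a
  rw [innerSL_apply_apply]
  exact inner_basisTensor_of_ne (fun e => hb ⟨a, e.symm⟩) _ _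

theorem idTensor_apply [CompleteSpace F] (U : E →ₗᵢ[ℂ] F) (f : lp (fun _ : ι => E) 2) (a : ι) :
    idTensor U f a = U (f a) := by
  classical
  refine ext_inner_left ℂ fun x => ?_
  rw [← inner_basisTensor_left]
  have h := OrthogonalFamily.hasSum_linearIsometry (𝕜 := ℂ) (G := fun _ : ι => E)
    (V := fun a => (basisTensor a).comp U)
    (fun _ _ hab x y => inner_basisTensor_of_ne hab (U x) (U y)) f
  have h' := h.mapL (innerSL ℂ (basisTensor a x))
  refine h'.unique ?_
  convert hasSum_single a ?_ using 1
  · rw [innerSL_apply_apply]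
    change _ = ⟪basisTensor a x, basisTensor a (U (f a))⟫_ℂ
    rw [LinearIsometry.inner_map_map]
  · intro b hb
    rw [innerSL_apply_apply]
    exact inner_basisTensor_of_ne hb.symm _ _

end General

/-! ## Elementary tensors -/

theorem hasSum_mul_prod {A B : Type} (f : A → ℂ) (g : B → ℂ) (hf : Summable fun a => ‖f a‖)
    (hg : Summable fun b => ‖g b‖) :
    HasSum (fun p : A × B => f p.1 * g p.2) ((∑' a, f a) * ∑' b, g b) := by
  rw [tsum_mul_tsum_of_summable_norm hf hg]
  exact (summable_mul_of_summable_norm hf hg).hasSum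

theorem hasSum_prod_pi {k : ℕ} {A : Fin k → Type} (f : ∀ i, A i → ℂ)
    (hf : ∀ i, Summable fun a => ‖f i a‖) :
    (Summable fun a : ∀ i, A i => ‖∏ i, f i (a i)‖) ∧
      HasSum (fun a : ∀ i, A i => ∏ i, f i (a i)) (∏ i, ∑' a, f i a) := by
  induction k with
  | zero =>
    refine ⟨Summable.of_finite, ?_⟩
    convert hasSum_unique (fun a : ∀ i, A i => ∏ i, f i (a i)) using 1
    simp
  | succ k ih =>
    obtain ⟨h1, h2⟩ := ih (fun i => f i.succ) (fun i => hf i.succ)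
    have h3 : Summable fun p : A 0 × (∀ i : Fin k, A i.succ) =>
        ‖f 0 p.1 * ∏ i : Fin k, f i.succ (p.2 i)‖ := 
      Summable.mul_norm (f := f 0) (g := fun b : (∀ i : Fin k, A i.succ) => ∏ i : Fin k, f i.succ (b i))
        (hf 0) h1
    have h4 := hasSum_mul_prod (f 0) (fun b : (∀ i : Fin k, A i.succ) => ∏ i : Fin k, f i.succ (b i))
      (hf 0) h1
    rw [h2.tsum_eq] at h4
    constructor
    · rw [← (Fin.consEquiv A).summable_iff]
      convert h3 using 2 with p
      simp [Fin.prod_univ_succ, Fin.consEquiv]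
    · rw [← (Fin.consEquiv A).hasSum_iff, Fin.prod_univ_succ]
      convert h4 using 2 with p
      simp [Fin.prod_univ_succ, Fin.consEquiv]

section Tensor

variable {k : ℕ} {n : Fin k → ℕ} {E F : Type*} [NormedAddCommGroup E] [InnerProductSpace ℂ E]
  [NormedAddCommGroup F] [InnerProductSpace ℂ F]

theorem memlp_tmul (f : ∀ i, Fock (n i)) (x : E) :
    Memℓp (fun α : MultiWord n => (∏ i, f i (α i)) • x) 2 := by
  refine memℓp_gen ?_
  have h : ∀ i, Summable fun a => ‖((‖f i a‖ ^ 2 : ℝ) : ℂ)‖ := fun i => by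
    have := (lp.memℓp (f i)).summable (by norm_num)
    simpa using this
  have h2 := (hasSum_prod_pi (fun i a => ((‖f i a‖ ^ 2 : ℝ) : ℂ)) h).1
  refine (h2.mul_right (‖x‖ ^ 2)).congr fun α => ?_
  simp [norm_smul, mul_pow, Finset.prod_pow]

/-- The elementary tensor `f₁ ⊗ ⋯ ⊗ f_k ⊗ x`. -/
def tmul (f : ∀ i, Fock (n i)) (x : E) : FockTensor n E :=
  ⟨fun α => (∏ i, f i (α i)) • x, memlp_tmul f x⟩

theorem tmul_apply (f : ∀ i, Fock (n i)) (x : E) (α : MultiWord n) :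
    tmul f x α = (∏ i, f i (α i)) • x := rfl

/-- `⟨f₁ ⊗ ⋯ ⊗ f_k ⊗ x, g₁ ⊗ ⋯ ⊗ g_k ⊗ y⟩ = ⟨f₁, g₁⟩ ⋯ ⟨f_k, g_k⟩ ⟨x, y⟩`. -/
theorem inner_tmul (f g : ∀ i, Fock (n i)) (x y : E) :
    ⟪tmul f x, tmul g y⟫_ℂ = (∏ i, ⟪f i, g i⟫_ℂ) * ⟪x, y⟫_ℂ := by
  have hs : ∀ i, Summable fun a => ‖⟪f i a, g i a⟫_ℂ‖ := fun i =>
    (lp.summable_inner (𝕜 := ℂ) (f i) (g i)).norm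
  have h := (hasSum_prod_pi (fun i a => ⟪f i a, g i a⟫_ℂ) hs).2.mul_right ⟪x, y⟫_ℂ
  have h2 := lp.hasSum_inner (𝕜 := ℂ) (tmul f x) (tmul g y)
  refine h2.unique ?_
  have e : ∀ i, ⟪f i, g i⟫_ℂ = ∑' a, ⟪f i a, g i a⟫_ℂ := fun i => lp.inner_eq_tsum _ _
  rw [Finset.prod_congr rfl fun i _ => e i]
  refine (iff_of_eq (congrArg (HasSum · _) (funext fun α => ?_))).mpr h
  change ⟪(∏ i, f i (α i)) • x, (∏ i, g i (α i)) • y⟫_ℂ = _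
  simp only [inner_smul_left, inner_smul_right, map_prod, RCLike.inner_apply,
    Finset.prod_mul_distrib]
  ring

theorem tmul_basisTensor (α : MultiWord n) (x : E) :
    tmul (fun i => basisTensor (α i) (1 : ℂ)) x = basisTensor α x := by
  classical
  ext β
  rw [tmul_apply, basisTensor_apply]
  simp only [basisTensor_apply]
  by_cases h : β = α
  · subst h
    simp
  · obtain ⟨i, hi⟩ := Function.ne_iff.mp h
    rw [if_neg h, Finset.prod_eq_zero (Finset.mem_univ i) (if_neg hi), zero_smul]

theorem dense_span_tmul :
    (Submodule.span ℂ (Set.range fun p : (∀ i, Fock (n i)) × E =>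
      tmul p.1 p.2)).topologicalClosure = ⊤ := by
  classical
  refine eq_top_iff.mpr fun f _ => ?_
  have h := lp.hasSum_single (E := fun _ : MultiWord n => E) (p := 2) (by norm_num) f
  refine mem_closure_of_tendsto h (Filter.Eventually.of_forall fun s => ?_)
  refine Submodule.sum_mem _ fun α _ => Submodule.subset_span
    ⟨(fun i => basisTensor (α i) (1 : ℂ), f α), ?_⟩
  exact (tmul_basisTensor α (f α)).trans (basisTensor_eq_single α (f α))

/-! ## The universal model -/

/-- The left creation operator `S_j` on the full Fock space, `S_j e_α = e_{g_j α}`. -/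
def leftCreation {m : ℕ} (j : Fin m) : Fock m →ₗᵢ[ℂ] Fock m :=
  basisShift (fun α => FreeMonoid.of j * α) (mul_right_injective _)

/-- Multiplication on the left by the generator `g_j` in the `i`-th word. -/
def consWord (i : Fin k) (j : Fin (n i)) (α : MultiWord n) : MultiWord n :=
  Function.update α i (FreeMonoid.of j * α i)

theorem consWord_injective (i : Fin k) (j : Fin (n i)) :
    Function.Injective (consWord (n := n) i j) := by
  intro α β h
  funext l
  have hl := congrFun h l
  by_cases hli : l = i
  · subst hli
    simpa [consWord] using hl
  · simpa [consWord, Function.update_of_ne hli] using hl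

/-- The operator `𝐒_{i,j} ⊗ I_E`, where `𝐒_{i,j}` is `S_{i,j}` acting on the `i`-th factor:
`e_{α₁} ⊗ ⋯ ⊗ e_{α_i} ⊗ ⋯ ⊗ e_{α_k} ⊗ x ↦ e_{α₁} ⊗ ⋯ ⊗ e_{g_j α_i} ⊗ ⋯ ⊗ e_{α_k} ⊗ x`. -/
def model (n : Fin k → ℕ) (E : Type*) [NormedAddCommGroup E] [InnerProductSpace ℂ E]
    [CompleteSpace E] (p : Σ i : Fin k, Fin (n i)) : FockTensor n E →L[ℂ] FockTensor n E :=
  (basisShift (consWord p.1 p.2) (consWord_injective p.1 p.2)).toContinuousLinearMap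

theorem model_tmul [CompleteSpace E] (i : Fin k) (j : Fin (n i)) (f : ∀ i, Fock (n i)) (x : E) :
    model n E ⟨i, j⟩ (tmul f x) = tmul (Function.update f i (leftCreation j (f i))) x := by
  classical
  ext β
  change basisShift (consWord i j) (consWord_injective i j) (tmul f x) β = _
  by_cases hβ : ∃ w, FreeMonoid.of j * w = β i
  · obtain ⟨w, hw⟩ := hβ
    have hβ' : consWord i j (Function.update β i w) = β := by
      simp [consWord, hw]
    conv_lhs => rw [← hβ']
    rw [basisShift_apply, tmul_apply, tmul_apply]
    congr 1
    refine Finset.prod_congr rfl fun l _ => ?_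
    by_cases hl : l = i
    · subst hl
      rw [Function.update_self, Function.update_self, ← hw]
      exact (basisShift_apply _ (mul_right_injective (FreeMonoid.of j)) (f l) w).symm
    · rw [Function.update_of_ne hl, Function.update_of_ne hl]
  · rw [basisShift_apply_of_notMem, tmul_apply, Finset.prod_eq_zero (Finset.mem_univ i), zero_smul]
    · rw [Function.update_self]
      exact basisShift_apply_of_notMem _ (mul_right_injective (FreeMonoid.of j)) _ _ hβ
    · rintro ⟨γ, rfl⟩
      exact hβ ⟨γ i, by simp [consWord]⟩

theorem idTensor_tmul [CompleteSpace F] (U : E →ₗᵢ[ℂ] F) (f : ∀ i, Fock (n i)) (x : E) :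
    idTensor U (tmul f x) = tmul f (U x) := by
  ext α
  rw [idTensor_apply, tmul_apply, tmul_apply, map_smul]

end Tensor

/-! ## Tuples of operators: subspaces, compressions, unitary equivalence -/

section Tuples

variable {ι : Type*} {H K : Type*} [NormedAddCommGroup H] [InnerProductSpace ℂ H]
  [NormedAddCommGroup K] [InnerProductSpace ℂ K]

/-- The closed subspace `M` is invariant under every operator of the tuple `T`. -/
def IsInvariant (T : ι → H →L[ℂ] H) (M : ClosedSubmodule ℂ H) : Prop :=
  ∀ p, ∀ x ∈ M, T p x ∈ M

/-- The closed subspace `M` is reducing for the tuple `T`: it is invariant under every operator of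
the tuple and under their adjoints. -/
def IsReducing [CompleteSpace H] (T : ι → H →L[ℂ] H) (M : ClosedSubmodule ℂ H) : Prop :=
  ∀ p, ∀ x ∈ M, T p x ∈ M ∧ ContinuousLinearMap.adjoint (T p) x ∈ M

/-- `M` contains no reducing subspace of `T` other than the trivial ones, `{0}` and `H`. -/
def ContainsNoNontrivialReducing [CompleteSpace H] (T : ι → H →L[ℂ] H)
    (M : ClosedSubmodule ℂ H) : Prop :=
  ∀ R : ClosedSubmodule ℂ H, IsReducing T R → R ≤ M →
    R.toSubmodule = ⊥ ∨ R.toSubmodule = ⊤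

/-- The orthogonal projection of `H` onto the closed subspace `M`, as an operator on `H`. -/
def proj [CompleteSpace H] (M : ClosedSubmodule ℂ H) : H →L[ℂ] H :=
  M.toSubmodule.starProjection

/-- The compression `P_{Mᗮ} T |_{Mᗮ}` of the tuple `T` to the orthogonal complement of `M`. -/
def compression [CompleteSpace H] (T : ι → H →L[ℂ] H) (M : ClosedSubmodule ℂ H) (p : ι) :
    M.toSubmoduleᗮ →L[ℂ] M.toSubmoduleᗮ :=
  M.toSubmoduleᗮ.orthogonalProjectionOnto ∘L T p ∘L M.toSubmoduleᗮ.subtypeL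

/-- The tuples `A` and `B` are unitarily equivalent: a single unitary operator intertwines all
pairs of entries. -/
def UnitarilyEquivalent (A : ι → H →L[ℂ] H) (B : ι → K →L[ℂ] K) : Prop :=
  ∃ Z : H ≃ₗᵢ[ℂ] K, ∀ p x, Z (A p x) = B p (Z x)

/-- An operator is a partial isometry if it is isometric on the orthogonal complement of its
kernel. -/
def IsPartialIsometry (Ψ : H →L[ℂ] K) : Prop :=
  ∀ x ∈ (LinearMap.ker Ψ.toLinearMap)ᗮ, ‖Ψ x‖ = ‖x‖

end Tuples

section Beurling

universe u

variable {k : ℕ} {n : Fin k → ℕ}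

/-- `Ψ` is multi-analytic: `Ψ (𝐒_{i,j} ⊗ I_L) = (𝐒_{i,j} ⊗ I_E) Ψ` for all `i, j`. -/
def IsMultiAnalytic {L E : Type u} [NormedAddCommGroup L] [InnerProductSpace ℂ L]
    [CompleteSpace L] [NormedAddCommGroup E] [InnerProductSpace ℂ E] [CompleteSpace E]
    (Ψ : FockTensor n L →L[ℂ] FockTensor n E) : Prop :=
  ∀ p, Ψ ∘L model n L p = model n E p ∘L Ψ

/-- `M` is of Beurling type: it is the range of an inner multi-analytic operator, that is, of a
multi-analytic partial isometry, defined on `F²(H_{n₁}) ⊗ ⋯ ⊗ F²(H_{n_k}) ⊗ L` for some Hilbert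
space `L`. -/
def IsBeurlingType {E : Type u} [NormedAddCommGroup E] [InnerProductSpace ℂ E] [CompleteSpace E]
    (M : ClosedSubmodule ℂ (FockTensor n E)) : Prop :=
  ∃ (L : Type u) (_ : NormedAddCommGroup L) (_ : InnerProductSpace ℂ L) (_ : CompleteSpace L)
    (Ψ : FockTensor n L →L[ℂ] FockTensor n E),
    IsMultiAnalytic Ψ ∧ IsPartialIsometry Ψ ∧ (M : Set (FockTensor n E)) = Set.range Ψ

/-- The operator `I ⊗ U` on `F²(H_{n₁}) ⊗ ⋯ ⊗ F²(H_{n_k}) ⊗ E`, for a unitary operator `U` on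
`E`. -/
def ampliation (n : Fin k → ℕ) {E : Type u} [NormedAddCommGroup E] [InnerProductSpace ℂ E]
    [CompleteSpace E] (U : E ≃ₗᵢ[ℂ] E) : FockTensor n E →L[ℂ] FockTensor n E :=
  (idTensor U.toLinearIsometry).toContinuousLinearMap

end Beurling

end Polyball

end

noncomputable section

namespace Polyball

open scoped InnerProductSpace

/-! ### Words, coefficients and vacuum projections. -/

section FockCoefficients

variable {k : ℕ} {n : Fin k → ℕ} {E F : Type*} [NormedAddCommGroup E] [InnerProductSpace ℂ E]
  [NormedAddCommGroup F] [InnerProductSpace ℂ F]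

/-! Since `M` is invariant, the adjoints of the compressions are the restrictions of the adjoint
models `S*` to `Mᗮ`, so a unitary equivalence `Z : Mᗮ → Nᗮ` intertwines these restrictions
(`UnitarilyEquivalent.exists_intertwining_adjoint`). The squared norm of the vacuum coefficient of
`f` is determined by the norms of iterated `S*` applied to `f` (`vacuumNormSq_insert`). Hence `Z`
preserves it (`norm_vacuum_coeff_eq`), and sending the vacuum coefficient of `x` to that of `Z x` is
a well-defined isometry between subspaces of `E`. These are dense when `M` and `N` are proper,
because otherwise a nontrivial reducing subspace would appear (`denseRange_vacuumCoeff`); the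
isometry therefore extends to a unitary `U`. Every coefficient of `x` is the vacuum coefficient of
some iterated `S*` applied to `x`, so `I ⊗ U` extends `Z`, and an isometry that carries `Mᗮ` onto
`Nᗮ` intertwines the projections.

Conversely, `I ⊗ U` commutes with the models, and when it intertwines the projections it restricts
to a unitary from `Mᗮ` onto `Nᗮ` implementing the equivalence. -/

/-- The coefficient functional `∑ e_β ⊗ x_β ↦ x_α`. -/
def coeffL (n : Fin k → ℕ) (E : Type*) [NormedAddCommGroup E] [InnerProductSpace ℂ E]
    (α : MultiWord n) : FockTensor n E →L[ℂ] E :=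
  lp.evalCLM ℂ (fun _ : MultiWord n => E) 2 α

/-- A word whose `i`-th component is not empty has the form `consWord i j β`. -/
theorem exists_consWord_eq {α : MultiWord n} {i : Fin k} (h : α i ≠ 1) :
    ∃ j β, consWord i j β = α := by
  cases hα : α i using FreeMonoid.casesOn with
  | one => exact absurd hα h
  | of_mul j w => exact ⟨j, Function.update α i w, by simp [consWord, ← hα]⟩

theorem consWord_ne_one (i : Fin k) (j : Fin (n i)) (β : MultiWord n) : consWord i j β i ≠ 1 := by
  intro h
  have := congrArg FreeMonoid.length h
  simp [consWord, FreeMonoid.length_mul] at this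

theorem eq_of_consWord_eq {i : Fin k} {j j' : Fin (n i)} {β β' : MultiWord n}
    (h : consWord i j β = consWord i j' β') : j = j' := by
  have := congrArg FreeMonoid.toList (congrFun h i)
  simp [consWord, FreeMonoid.toList_mul] at this
  exact this.1

/-- Induction on tuples of words by prefixing generators. -/
theorem consWord_induction {P : MultiWord n → Prop} (one : P 1)
    (cons : ∀ i j β, P β → P (consWord i j β)) (α : MultiWord n) : P α := by
  -- Removing a generator lowers the total length of the tuple.
  induction hl : ∑ i, (α i).length using Nat.strong_induction_on generalizing α with
  | _ l ih =>
    by_cases h : ∃ i, α i ≠ 1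
    · obtain ⟨i, hi⟩ := h
      obtain ⟨j, β, rfl⟩ := exists_consWord_eq hi
      refine cons i j β (ih _ ?_ β rfl)
      rw [← hl]
      refine Finset.sum_lt_sum (fun l _ => ?_) ⟨i, Finset.mem_univ i, ?_⟩
      · by_cases hli : l = i
        · subst hli
          simp [consWord, FreeMonoid.length_mul]
        · simp [consWord, Function.update_of_ne hli]
      · simp [consWord, FreeMonoid.length_mul]
    · push Not at h
      rwa [show α = 1 from funext h]

/-- `‖P_s f‖²`, where `P_s` is the projection onto the span of the vectors `e_α ⊗ x` with
`α i` empty for all `i ∈ s`. -/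
def vacuumNormSq (s : Finset (Fin k)) (f : FockTensor n E) : ℝ :=
  ∑' α, {α : MultiWord n | ∀ i ∈ s, α i = 1}.indicator (fun α => ‖f α‖ ^ 2) α

theorem hasSum_vacuumNormSq (s : Finset (Fin k)) (f : FockTensor n E) :
    HasSum ({α : MultiWord n | ∀ i ∈ s, α i = 1}.indicator fun α => ‖f α‖ ^ 2)
      (vacuumNormSq s f) := by
  have h : Summable fun α => ‖f α‖ ^ 2 := by
    simpa using (lp.memℓp f).summable (by norm_num)
  exact (h.indicator _).hasSum

theorem vacuumNormSq_empty (f : FockTensor n E) : vacuumNormSq ∅ f = ‖f‖ ^ 2 := by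
  have h := lp.norm_rpow_eq_tsum (p := 2) (by norm_num) f
  simp only [ENNReal.toReal_ofNat, Real.rpow_ofNat] at h
  simp [vacuumNormSq, h]

theorem vacuumNormSq_univ (f : FockTensor n E) : vacuumNormSq Finset.univ f = ‖f 1‖ ^ 2 := by
  refine (hasSum_vacuumNormSq _ f).unique ?_
  convert hasSum_single (1 : MultiWord n) ?_ using 1
  · simp
  · intro α hα
    refine Set.indicator_of_notMem (fun h : ∀ i ∈ Finset.univ, α i = 1 =>
      hα (funext fun i => h i (Finset.mem_univ i))) _

variable [CompleteSpace E] [CompleteSpace F]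

theorem model_basisTensor (p : Σ i : Fin k, Fin (n i)) (α : MultiWord n) (x : E) :
    model n E p (basisTensor α x) = basisTensor (consWord p.1 p.2 α) x :=
  basisShift_basisTensor _ (consWord_injective _ _) _ _

theorem model_apply_consWord (p : Σ i : Fin k, Fin (n i)) (f : FockTensor n E)
    (α : MultiWord n) : model n E p f (consWord p.1 p.2 α) = f α :=
  basisShift_apply _ (consWord_injective _ _) _ _

theorem model_apply_of_notMem (p : Σ i : Fin k, Fin (n i)) (f : FockTensor n E)
    {α : MultiWord n} (h : α ∉ Set.range (consWord p.1 p.2)) : model n E p f α = 0 :=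
  basisShift_apply_of_notMem _ (consWord_injective _ _) _ _ h

theorem adjoint_model_apply (p : Σ i : Fin k, Fin (n i)) (f : FockTensor n E)
    (α : MultiWord n) :
    (ContinuousLinearMap.adjoint (model n E p) f) α = f (consWord p.1 p.2 α) := by
  refine ext_inner_left ℂ fun x => ?_
  rw [← inner_basisTensor_left, ← inner_basisTensor_left, ContinuousLinearMap.adjoint_inner_right,
    model_basisTensor]

/-- `I ⊗ U` intertwines the universal models. -/
theorem idTensor_model (U : E →ₗᵢ[ℂ] F) (p : Σ i : Fin k, Fin (n i)) (f : FockTensor n E) :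
    (idTensor U (model n E p f) : FockTensor n F) = model n F p (idTensor U f) := by
  ext α
  rw [idTensor_apply]
  by_cases h : α ∈ Set.range (consWord p.1 p.2)
  · obtain ⟨β, rfl⟩ := h
    rw [model_apply_consWord, model_apply_consWord, idTensor_apply]
  · rw [model_apply_of_notMem p _ h, model_apply_of_notMem p _ h, map_zero]

/-- Words that are empty on `s` split according to their `i`-th component: either it is empty too,
or it starts with exactly one generator `j`. Stripping that generator is what `S*_{i,j}` does to
coefficients. -/
theorem vacuumNormSq_insert {s : Finset (Fin k)} {i : Fin k} (hi : i ∉ s) (f : FockTensor n E) :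
    vacuumNormSq s f = vacuumNormSq (insert i s) f +
      ∑ j, vacuumNormSq s (ContinuousLinearMap.adjoint (model n E ⟨i, j⟩) f) := by
  classical
  have hj : ∀ j : Fin (n i), HasSum ((Set.range (consWord i j)).indicator
      ({α : MultiWord n | ∀ i ∈ s, α i = 1}.indicator fun α => ‖f α‖ ^ 2))
      (vacuumNormSq s (ContinuousLinearMap.adjoint (model n E ⟨i, j⟩) f)) := fun j => by
    rw [← (consWord_injective i j).hasSum_iff fun α hα => Set.indicator_of_notMem hα _]
    refine (iff_of_eq (congrArg (HasSum · _) (funext fun β => ?_))).mpr (hasSum_vacuumNormSq s _)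
    -- As `i ∉ s`, prefixing in the `i`-th word leaves the components in `s` alone.
    have h : (∀ l ∈ s, consWord i j β l = 1) ↔ ∀ l ∈ s, β l = 1 :=
      forall₂_congr fun l hl => by
        rw [consWord, Function.update_of_ne (ne_of_mem_of_not_mem hl hi)]
    simp only [Function.comp_apply, Set.indicator_apply, Set.mem_range_self, if_true,
      Set.mem_ofPred_eq, h, adjoint_model_apply]
  refine (hasSum_vacuumNormSq s f).unique ?_
  refine (iff_of_eq (congrArg (HasSum · _) (funext fun α => ?_))).mpr
    ((hasSum_vacuumNormSq (insert i s) f).add (hasSum_sum fun j (_ : j ∈ Finset.univ) => hj j))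
  by_cases h : α i = 1
  · have h0 : ∀ j, α ∉ Set.range (consWord i j) := by
      intro j hα
      obtain ⟨β, rfl⟩ := hα
      exact consWord_ne_one i j β h
    rw [Finset.sum_eq_zero fun j _ => Set.indicator_of_notMem (h0 j) _, add_zero]
    simp [Set.indicator_apply, h]
  · obtain ⟨j, β, rfl⟩ := exists_consWord_eq h
    rw [Finset.sum_eq_single_of_mem j (Finset.mem_univ j), Set.indicator_of_mem (Set.mem_range_self β)]
    · simp [Set.indicator_apply, h]
    · rintro j' - hj'
      refine Set.indicator_of_notMem ?_ _
      rintro ⟨β', h'⟩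
      exact hj' (eq_of_consWord_eq h')

/-- A norm-preserving map between subspaces that are invariant under the adjoints of the universal
models, and which intertwines these adjoints, preserves the norm of the vacuum coefficient. -/
theorem norm_vacuum_coeff_eq {X : Submodule ℂ (FockTensor n E)} {g : X → FockTensor n F}
    (hX : ∀ p, ∀ x ∈ X, ContinuousLinearMap.adjoint (model n E p) x ∈ X)
    (hg : ∀ x, ‖g x‖ = ‖x‖)
    (hgX : ∀ p (x : X), g ⟨_, hX p x x.2⟩ = ContinuousLinearMap.adjoint (model n F p) (g x)) (x : X) :
    ‖(g x) 1‖ = ‖(x : FockTensor n E) 1‖ := by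
  -- The statement is for all `x` at once: the induction step also applies it to the vectors
  -- `S*_{i,j} x`.
  have key : ∀ s : Finset (Fin k), ∀ x : X,
      vacuumNormSq s (g x) = vacuumNormSq s (x : FockTensor n E) := by
    intro s
    induction s using Finset.induction_on with
    | empty => intro x; rw [vacuumNormSq_empty, vacuumNormSq_empty, hg]; rfl
    | insert i s hi ih =>
      intro x
      have h1 := vacuumNormSq_insert hi (g x)
      have h2 := vacuumNormSq_insert hi (x : FockTensor n E)
      have h3 : ∀ p, vacuumNormSq s (ContinuousLinearMap.adjoint (model n F p) (g x)) =
          vacuumNormSq s (ContinuousLinearMap.adjoint (model n E p) (x : FockTensor n E)) :=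
        fun p => by rw [← hgX, ih]
      simp only [h3, ih] at h1
      linarith
  have h := key Finset.univ x
  rw [vacuumNormSq_univ, vacuumNormSq_univ] at h
  exact (sq_eq_sq₀ (norm_nonneg _) (norm_nonneg _)).mp h

end FockCoefficients

/-! ### Compressions and projections in an arbitrary Hilbert space. -/

section Compressions

variable {ι H : Type*} [NormedAddCommGroup H] [InnerProductSpace ℂ H] [CompleteSpace H]

theorem IsInvariant.adjoint_mem_orthogonal {T : ι → H →L[ℂ] H} {M : ClosedSubmodule ℂ H}
    (hM : IsInvariant T M) (p : ι) {x : H} (hx : x ∈ M.toSubmoduleᗮ) :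
    ContinuousLinearMap.adjoint (T p) x ∈ M.toSubmoduleᗮ := by
  rw [Submodule.mem_orthogonal] at hx ⊢
  intro y hy
  rw [ContinuousLinearMap.adjoint_inner_right]
  exact hx _ (hM p y hy)

/-- The projection in the compression disappears on passing to adjoints, because `Mᗮ` is invariant
under `(T p)*`. -/
theorem coe_adjoint_compression {T : ι → H →L[ℂ] H} {M : ClosedSubmodule ℂ H}
    (hM : IsInvariant T M) (p : ι) (x : M.toSubmoduleᗮ) :
    (ContinuousLinearMap.adjoint (compression T M p) x : H) =
      ContinuousLinearMap.adjoint (T p) (x : H) := by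
  have h : ContinuousLinearMap.adjoint (compression T M p) x =
      ⟨_, hM.adjoint_mem_orthogonal p x.2⟩ := by
    refine ext_inner_left ℂ fun y => ?_
    rw [ContinuousLinearMap.adjoint_inner_right, Submodule.coe_inner,
      Submodule.coe_inner, ContinuousLinearMap.adjoint_inner_right]
    change ⟪M.toSubmoduleᗮ.starProjection (T p y), (x : H)⟫_ℂ = _
    rw [Submodule.inner_starProjection_left_eq_right,
      Submodule.starProjection_eq_self_iff.mpr x.2]
  rw [h]

theorem mem_of_forall_inner_orthogonal_eq_zero {M : ClosedSubmodule ℂ H} {f : H}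
    (h : ∀ x ∈ M.toSubmoduleᗮ, ⟪x, f⟫_ℂ = 0) : f ∈ M := by
  rw [← ClosedSubmodule.mem_toSubmodule_iff, ← M.toSubmodule.orthogonal_orthogonal]
  exact (Submodule.mem_orthogonal _ _).mpr h

/-- Apply `V` to the decomposition of `f` along `M` and `Mᗮ`. The second part lands in `Nᗮ`; the
first is orthogonal to `V Mᗮ = Nᗮ`, so it lies in `N`. Surjectivity of `V` is not needed. -/
theorem intertwines_proj_of_map_orthogonal {M N : ClosedSubmodule ℂ H} {V : H →L[ℂ] H}
    (hV : ∀ x y, ⟪V x, V y⟫_ℂ = ⟪x, y⟫_ℂ) (Z : M.toSubmoduleᗮ ≃ₗᵢ[ℂ] N.toSubmoduleᗮ)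
    (hZ : ∀ x : M.toSubmoduleᗮ, V x = Z x) : V ∘L proj M = proj N ∘L V := by
  ext f
  change V (M.toSubmodule.starProjection f) = N.toSubmodule.starProjection (V f)
  symm
  refine Submodule.eq_starProjection_of_mem_orthogonal ?_ ?_
  · refine mem_of_forall_inner_orthogonal_eq_zero fun y hy => ?_
    have h : y = V (Z.symm ⟨y, hy⟩ : M.toSubmoduleᗮ) := by rw [hZ]; simp
    rw [h, hV]
    exact Submodule.inner_left_of_mem_orthogonal (Submodule.starProjection_apply_mem _ _)
      (Z.symm ⟨y, hy⟩).2
  · rw [← map_sub, hZ ⟨_, M.toSubmodule.sub_starProjection_mem_orthogonal f⟩]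
    exact (Z _).2

theorem unitarilyEquivalent_compression {T : ι → H →L[ℂ] H} {M N : ClosedSubmodule ℂ H}
    (V : H ≃ₗᵢ[ℂ] H) (hT : ∀ p x, V (T p x) = T p (V x))
    (hV : ∀ x, V (M.toSubmodule.starProjection x) = N.toSubmodule.starProjection (V x)) :
    UnitarilyEquivalent (compression T M) (compression T N) := by
  have hmap : M.toSubmoduleᗮ.map (V.toLinearEquiv : H →ₗ[ℂ] H) = N.toSubmoduleᗮ := by
    ext y
    rw [Submodule.mem_map_equiv, ← Submodule.starProjection_apply_eq_zero_iff,
      ← Submodule.starProjection_apply_eq_zero_iff, ← V.map_eq_zero_iff, hV]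
    change N.toSubmodule.starProjection (V (V.symm y)) = 0 ↔ _
    rw [V.apply_symm_apply]
  have hV' : ∀ x, V (M.toSubmoduleᗮ.starProjection x) = N.toSubmoduleᗮ.starProjection (V x) := by
    intro x
    rw [Submodule.starProjection_orthogonal_val, Submodule.starProjection_orthogonal_val, map_sub,
      hV]
  refine ⟨(V.submoduleMap _).trans (LinearIsometryEquiv.ofEq _ _ hmap), fun p x => ?_⟩
  refine Subtype.ext ?_
  change V (M.toSubmoduleᗮ.starProjection (T p x)) = N.toSubmoduleᗮ.starProjection (T p (V x))
  rw [hV', hT]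

end Compressions

/-! ### Density of the vacuum coefficients and construction of `U`. -/

section Main

variable {k : ℕ} {n : Fin k → ℕ} {E : Type*} [NormedAddCommGroup E] [InnerProductSpace ℂ E]

/-- The tensors all of whose coefficients lie in `Dᗮ`. -/
def tensorOrthogonal (n : Fin k → ℕ) (D : Submodule ℂ E) : ClosedSubmodule ℂ (FockTensor n E) :=
  ⨅ α : MultiWord n, (⟨Dᗮ, D.isClosed_orthogonal⟩ : ClosedSubmodule ℂ E).comap (coeffL n E α)

theorem mem_tensorOrthogonal {D : Submodule ℂ E} {f : FockTensor n E} :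
    f ∈ tensorOrthogonal n D ↔ ∀ α, f α ∈ Dᗮ := by
  rw [tensorOrthogonal, ClosedSubmodule.mem_iInf]
  rfl

/-- The vacuum coefficient, as a map on the orthogonal complement of `M`. -/
def vacuumCoeff (M : ClosedSubmodule ℂ (FockTensor n E)) : M.toSubmoduleᗮ →ₗ[ℂ] E :=
  (coeffL n E 1).toLinearMap ∘ₗ M.toSubmoduleᗮ.subtype

variable [CompleteSpace E]

theorem isReducing_tensorOrthogonal (D : Submodule ℂ E) :
    IsReducing (model n E) (tensorOrthogonal n D) := by
  intro p f hf
  rw [mem_tensorOrthogonal] at hf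
  simp only [mem_tensorOrthogonal]
  refine ⟨fun α => ?_, fun α => ?_⟩
  · by_cases h : α ∈ Set.range (consWord p.1 p.2)
    · obtain ⟨β, rfl⟩ := h
      rw [model_apply_consWord]
      exact hf β
    · rw [model_apply_of_notMem p f h]
      exact zero_mem _
  · rw [adjoint_model_apply]
    exact hf _

/-- Passing to `S*_{i,j} x`, which stays in `Mᗮ`, shortens the word until only the vacuum
coefficient is left. -/
theorem coeff_mem_range_vacuumCoeff {M : ClosedSubmodule ℂ (FockTensor n E)}
    (hM : IsInvariant (model n E) M) (α : MultiWord n) :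
    ∀ x : M.toSubmoduleᗮ, (x : FockTensor n E) α ∈ LinearMap.range (vacuumCoeff M) := by
  induction α using consWord_induction with
  | one => exact fun x => ⟨x, rfl⟩
  | cons i j β ih =>
    intro x
    rw [← adjoint_model_apply ⟨i, j⟩]
    exact ih ⟨_, hM.adjoint_mem_orthogonal _ x.2⟩

theorem tensorOrthogonal_range_vacuumCoeff_le {M : ClosedSubmodule ℂ (FockTensor n E)}
    (hM : IsInvariant (model n E) M) :
    tensorOrthogonal n (LinearMap.range (vacuumCoeff M)) ≤ M := by
  intro f hf
  rw [mem_tensorOrthogonal] at hf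
  refine mem_of_forall_inner_orthogonal_eq_zero fun x hx => ?_
  rw [lp.inner_eq_tsum]
  refine (tsum_congr fun α => ?_).trans tsum_zero
  exact Submodule.inner_right_of_mem_orthogonal (coeff_mem_range_vacuumCoeff hM α ⟨x, hx⟩) (hf α)

/-- If `M` is a proper invariant subspace without nontrivial reducing subspaces, the vacuum
coefficients of the vectors orthogonal to `M` are dense in `E`. -/
theorem denseRange_vacuumCoeff {M : ClosedSubmodule ℂ (FockTensor n E)}
    (hM : IsInvariant (model n E) M) (hMred : ContainsNoNontrivialReducing (model n E) M)
    (htop : M.toSubmodule ≠ ⊤) : DenseRange (vacuumCoeff M) := by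
  have hle := tensorOrthogonal_range_vacuumCoeff_le hM
  have hbot := (hMred _ (isReducing_tensorOrthogonal _) hle).resolve_right fun h =>
    htop (top_le_iff.mp (h ▸ ClosedSubmodule.toSubmodule_le_toSubmodule.mpr hle))
  have hD : (LinearMap.range (vacuumCoeff M)).topologicalClosure = ⊤ := by
    rw [Submodule.topologicalClosure_eq_top_iff, eq_bot_iff]
    intro u hu
    -- A vector `u` orthogonal to all vacuum coefficients puts `e_1 ⊗ u` in a reducing subspace
    -- known to be zero.
    have hmem : (basisTensor (1 : MultiWord n) u : FockTensor n E) ∈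
        (tensorOrthogonal n (LinearMap.range (vacuumCoeff M))).toSubmodule := by
      rw [ClosedSubmodule.mem_toSubmodule_iff, mem_tensorOrthogonal]
      intro α
      rw [basisTensor_apply]
      split_ifs
      exacts [hu, zero_mem _]
    rw [hbot, Submodule.mem_bot, map_eq_zero_iff _ (basisTensor _).injective] at hmem
    exact hmem
  rw [DenseRange, ← LinearMap.coe_range]
  exact Submodule.dense_iff_topologicalClosure_eq_top.mpr hD

theorem ampliation_apply (U : E ≃ₗᵢ[ℂ] E) (f : FockTensor n E) (α : MultiWord n) :
    ampliation n U f α = U (f α) :=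
  idTensor_apply _ _ _

/-- The unitary operator `I ⊗ U`. -/
def ampliationEquiv (n : Fin k → ℕ) (U : E ≃ₗᵢ[ℂ] E) : FockTensor n E ≃ₗᵢ[ℂ] FockTensor n E :=
  LinearIsometryEquiv.ofSurjective (idTensor U.toLinearIsometry) fun f =>
    ⟨idTensor U.symm.toLinearIsometry f, by
      ext α
      rw [idTensor_apply, idTensor_apply]
      exact U.apply_symm_apply _⟩

theorem UnitarilyEquivalent.exists_intertwining_adjoint
    {M N : ClosedSubmodule ℂ (FockTensor n E)}
    (hM : IsInvariant (model n E) M) (hN : IsInvariant (model n E) N)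
    (h : UnitarilyEquivalent (compression (model n E) M) (compression (model n E) N)) :
    ∃ Z : M.toSubmoduleᗮ ≃ₗᵢ[ℂ] N.toSubmoduleᗮ, ∀ p (x : M.toSubmoduleᗮ),
      (Z ⟨_, hM.adjoint_mem_orthogonal p x.2⟩ : FockTensor n E) =
        ContinuousLinearMap.adjoint (model n E p) (Z x : FockTensor n E) := by
  obtain ⟨Z, hZ⟩ := h
  refine ⟨Z, fun p x => ?_⟩
  have e : (⟨_, hM.adjoint_mem_orthogonal p x.2⟩ : M.toSubmoduleᗮ) =
      ContinuousLinearMap.adjoint (compression (model n E) M p) x :=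
    Subtype.ext (coe_adjoint_compression hM p x).symm
  rw [e, ← coe_adjoint_compression hN p (Z x)]
  congr 1
  refine ext_inner_left ℂ fun y => ?_
  obtain ⟨y, rfl⟩ := Z.surjective y
  rw [Z.inner_map_map, ContinuousLinearMap.adjoint_inner_right,
    ContinuousLinearMap.adjoint_inner_right, ← hZ, Z.inner_map_map]

theorem exists_ampliation_intertwining {M N : ClosedSubmodule ℂ (FockTensor n E)}
    (hM : IsInvariant (model n E) M) (hN : IsInvariant (model n E) N)
    (hMred : ContainsNoNontrivialReducing (model n E) M)
    (hNred : ContainsNoNontrivialReducing (model n E) N)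
    (h : UnitarilyEquivalent (compression (model n E) M) (compression (model n E) N)) :
    ∃ U : E ≃ₗᵢ[ℂ] E, ampliation n U ∘L proj M = proj N ∘L ampliation n U := by
  obtain ⟨Z, hZ⟩ := h.exists_intertwining_adjoint hM hN
  -- Matching vacuum coefficients is enough: the other coefficients follow by applying `S*` on both
  -- sides.
  suffices ∃ U : E ≃ₗᵢ[ℂ] E, ∀ x : M.toSubmoduleᗮ, U ((x : FockTensor n E) 1) =
      (Z x : FockTensor n E) 1 by
    obtain ⟨U, hU⟩ := this
    refine ⟨U, intertwines_proj_of_map_orthogonal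
      (fun x y => (idTensor U.toLinearIsometry).inner_map_map x y) Z fun x => ?_⟩
    ext α
    rw [ampliation_apply]
    induction α using consWord_induction generalizing x with
    | one => exact hU x
    | cons i j β ih =>
      have := ih ⟨_, hM.adjoint_mem_orthogonal ⟨i, j⟩ x.2⟩
      rwa [hZ, adjoint_model_apply, adjoint_model_apply] at this
  have htop : M.toSubmodule = ⊤ ↔ N.toSubmodule = ⊤ := by
    rw [← Submodule.orthogonal_eq_bot_iff, ← Submodule.orthogonal_eq_bot_iff,
      ← Submodule.subsingleton_iff_eq_bot, ← Submodule.subsingleton_iff_eq_bot]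
    exact Z.toEquiv.subsingleton_congr
  -- If `M` is everything, density may fail, but then `Mᗮ = 0` and any unitary will do.
  by_cases hMtop : M.toSubmodule = ⊤
  · have : Subsingleton M.toSubmoduleᗮ := by
      rw [Submodule.subsingleton_iff_eq_bot, Submodule.orthogonal_eq_bot_iff]
      exact hMtop
    refine ⟨LinearIsometryEquiv.refl ℂ E, fun x => ?_⟩
    rw [Subsingleton.elim x 0, map_zero]
    rfl
  · have hnorm : ∀ x, ‖vacuumCoeff N (Z.toLinearEquiv x)‖ = ‖vacuumCoeff M x‖ :=
      norm_vacuum_coeff_eq (g := fun x => (Z x : FockTensor n E))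
        (fun p x hx => hM.adjoint_mem_orthogonal p hx) Z.norm_map hZ
    exact ⟨Z.toLinearEquiv.extendOfIsometry _ _ (denseRange_vacuumCoeff hM hMred hMtop)
      (denseRange_vacuumCoeff hN hNred (mt htop.mpr hMtop)) hnorm,
      Z.toLinearEquiv.extendOfIsometry_eq _ _ _ _ hnorm⟩

theorem unitarilyEquivalent_compression_of_ampliation {M N : ClosedSubmodule ℂ (FockTensor n E)}
    (U : E ≃ₗᵢ[ℂ] E) (hU : ampliation n U ∘L proj M = proj N ∘L ampliation n U) :
    UnitarilyEquivalent (compression (model n E) M) (compression (model n E) N) :=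
  unitarilyEquivalent_compression (ampliationEquiv n U)
    (fun p x => idTensor_model U.toLinearIsometry p x) fun x => DFunLike.congr_fun hU x

end Main

end Polyball

end

theorem theorem3p6 {k : ℕ} (hk : 1 ≤ k) (n : Fin k → ℕ) (hn : ∀ i, 1 ≤ n i)
    {E : Type*} [NormedAddCommGroup E] [InnerProductSpace ℂ E] [CompleteSpace E]
    (M N : ClosedSubmodule ℂ (Polyball.FockTensor n E))
    (hM : Polyball.IsInvariant (Polyball.model n E) M)
    (hN : Polyball.IsInvariant (Polyball.model n E) N)
    (hMred : Polyball.ContainsNoNontrivialReducing (Polyball.model n E) M)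
    (hNred : Polyball.ContainsNoNontrivialReducing (Polyball.model n E) N) :
    (Polyball.UnitarilyEquivalent
        (Polyball.compression (Polyball.model n E) M)
        (Polyball.compression (Polyball.model n E) N) →
      ∃ U : E ≃ₗᵢ[ℂ] E,
        Polyball.ampliation n U ∘L Polyball.proj M = Polyball.proj N ∘L Polyball.ampliation n U) ∧
    (Polyball.IsBeurlingType M → Polyball.IsBeurlingType N →
      (∃ U : E ≃ₗᵢ[ℂ] E,
        Polyball.ampliation n U ∘L Polyball.proj M = Polyball.proj N ∘L Polyball.ampliation n U) →
      Polyball.UnitarilyEquivalent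
        (Polyball.compression (Polyball.model n E) M)
        (Polyball.compression (Polyball.model n E) N)) :=
  ⟨Polyball.exists_ampliation_intertwining hM hN hMred hNred, fun _ _ ⟨U, hU⟩ =>
    Polyball.unitarilyEquivalent_compression_of_ampliation U hU⟩
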